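/- Let $X\neq\{0\}$ be a real or complex Fréchet space (a complete metrizable locally convex topological vector space) and let $T:X\to X$ be a continuous linear operator. For $A\subset\mathbb{N}_0$ let $$\underline{\mathrm{dens}}(A)=\liminf_{N\to\infty}\frac{\mathrm{card}\{n\in A: n\le N\}}{N+1},\qquad \overline{\mathrm{dens}}(A)=\limsup_{N\to\infty}\frac{\mathrm{card}\{n\in A: n\le N\}}{N+1}.$$ Let $\mathrm{FRec}(T)$ be the set of frequently recurrent vectors of $T$, that is, of all $x\in X$ such that for every neighbourhood $U$ of $x$ the return set $\{n\ge 0: T^nx\in U\}$ has positive lower density. The orbit of $x\in X$ is called distributionally near to zero if there is a set $A\subset\mathbb{N}_0$ with $\overline{\mathrm{dens}}(A)=1$ such that $T^nx\to 0$ as $n\to\infty$, $n\in A$; it is called distributionally unbounded if there are a set $A\subset\mathbb{N}_0$ with $\overline{\mathrm{dens}}(A)=1$ and a continuous seminorm $p$ on $X$ such that $p(T^nx)\to\infty$ as $n\to\infty$, $n\in A$. Suppose that at least one of the following conditions is satisfied: (a) $T$ is hypercyclic, that is, some $x\in X$ has a dense orbit $\{T^nx:n\ge 0\}$; (b) some $x\in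 X$ has a distributionally unbounded orbit under $T$; (c) the set of vectors whose orbits are distributionally near to zero is dense in $X$; (d) the set of vectors $x\in X$ such that $T^nx\to 0$ as $n\to\infty$ is dense in $X$. Then $\mathrm{FRec}(T)$ is of first category in $X$, that is, a countable union of nowhere dense sets. -/

import Mathlib

open Filter Topology

noncomputable section

namespace LinRec

/-- The proportion `card {n ∈ A : n ≤ N} / (N + 1)`. -/
def proportion (A : Set ℕ) (N : ℕ) : ℝ :=
  ({n : ℕ | n ∈ A ∧ n ≤ N}.ncard : ℝ) / ((N : ℝ) + 1)

/-- Lower density of a set of non-negative integers. The proportions lie in `[0, 1]`, so the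
real-valued `liminf` is the usual one. -/
def lowerDensity (A : Set ℕ) : ℝ := liminf (proportion A) atTop

/-- Upper density of a set of non-negative integers. -/
def upperDensity (A : Set ℕ) : ℝ := limsup (proportion A) atTop

section Operators

variable {𝕜 X : Type*} [RCLike 𝕜] [AddCommGroup X] [Module 𝕜 X] [TopologicalSpace X]

/-- The return set `N(x, U) = {n ≥ 0 : Tⁿ x ∈ U}`. -/
def returnSet (T : X →L[𝕜] X) (x : X) (U : Set X) : Set ℕ := {n : ℕ | (T ^ n) x ∈ U}

/-- The set `FRec(T)` of frequently recurrent vectors. -/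
def FRec (T : X →L[𝕜] X) : Set X :=
  {x : X | ∀ U ∈ 𝓝 x, 0 < lowerDensity (returnSet T x U)}

/-- `T` is hypercyclic: some vector has a dense orbit. -/
def Hypercyclic (T : X →L[𝕜] X) : Prop :=
  ∃ x : X, Dense (Set.range fun n : ℕ => (T ^ n) x)

/-- The orbit of `x` is distributionally near to zero: `Tⁿ x → 0` as `n → ∞` within a set of
upper density one. -/
def DistributionallyNearZero (T : X →L[𝕜] X) (x : X) : Prop :=
  ∃ A : Set ℕ, upperDensity A = 1 ∧
    Tendsto (fun n : ℕ => (T ^ n) x) (atTop ⊓ 𝓟 A) (𝓝 0)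

/-- The orbit of `x` is distributionally unbounded: for some continuous seminorm `p`,
`p (Tⁿ x) → ∞` as `n → ∞` within a set of upper density one. -/
def DistributionallyUnbounded (T : X →L[𝕜] X) (x : X) : Prop :=
  ∃ A : Set ℕ, upperDensity A = 1 ∧ ∃ p : Seminorm 𝕜 X, Continuous p ∧
    Tendsto (fun n : ℕ => p ((T ^ n) x)) (atTop ⊓ 𝓟 A) atTop

end Operators

end LinRec

end

namespace LinRec

/-! ### Proportions and densities of sets of integers. -/

section Density

/-! For closed `C`, visiting `C` with proportion below `ε` up to some late time is an open condition
on `x`. If it is dense for all `ε`, `M` and countably many `C`, the generic orbit returns to each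
such `C` with lower density zero (`forall_rarelyVisiting_mem_residual`); when some `C` is a
neighbourhood of a point of the orbit, frequent recurrence fails (`notMem_FRec`).

It remains to choose `C` and prove density. Near-zero orbits rarely visit complements of
neighbourhoods of `0`. In the other two cases, every open set contains many vectors whose visits to
`C` almost exclude one another, so by pigeonhole (`exists_proportion_le`) one of them visits rarely.
-/

lemma finite_setOf_mem_and_le (A : Set ℕ) (N : ℕ) : {n : ℕ | n ∈ A ∧ n ≤ N}.Finite :=
  (Set.finite_Iic N).subset fun _ hn => hn.2

lemma proportion_nonneg (A : Set ℕ) (N : ℕ) : 0 ≤ proportion A N := by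
  unfold proportion; positivity

lemma proportion_le_one (A : Set ℕ) (N : ℕ) : proportion A N ≤ 1 := by
  unfold proportion
  rw [div_le_one (by positivity)]
  have h : {n : ℕ | n ∈ A ∧ n ≤ N}.ncard ≤ (Set.Iic N).ncard :=
    Set.ncard_le_ncard (fun _ hn => hn.2) (Set.finite_Iic N)
  have h' : (Set.Iic N).ncard = N + 1 := by
    rw [← Finset.coe_Iic, Set.ncard_coe_finset, Nat.card_Iic]
  rw [h'] at h
  exact_mod_cast h

lemma proportion_le_of_forall_le {A B : Set ℕ} {N : ℕ} (h : ∀ n ≤ N, n ∈ A → n ∈ B) :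
    proportion A N ≤ proportion B N := by
  unfold proportion
  have : {n : ℕ | n ∈ A ∧ n ≤ N}.ncard ≤ {n : ℕ | n ∈ B ∧ n ≤ N}.ncard :=
    Set.ncard_le_ncard (fun n hn => ⟨h n hn.2 hn.1, hn.2⟩) (finite_setOf_mem_and_le B N)
  gcongr

lemma proportion_mono {A B : Set ℕ} (h : A ⊆ B) (N : ℕ) : proportion A N ≤ proportion B N :=
  proportion_le_of_forall_le fun _ _ hA => h hA

lemma proportion_preimage_add_le (A : Set ℕ) (k N : ℕ) :
    proportion {n | n + k ∈ A} N ≤ proportion A N + k / ((N : ℝ) + 1) := by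
  unfold proportion
  rw [← add_div]
  gcongr
  have h₁ : {n : ℕ | n + k ∈ A ∧ n ≤ N}.ncard ≤
      ({n : ℕ | n ∈ A ∧ n ≤ N} ∪ Set.Ioc N (N + k)).ncard := by
    refine Set.ncard_le_ncard_of_injOn (· + k) ?_ (fun a _ b _ h => by simpa using h)
      ((finite_setOf_mem_and_le A N).union (Set.finite_Ioc _ _))
    rintro n ⟨hA, hN⟩
    by_cases h : n + k ≤ N
    · exact Or.inl ⟨hA, h⟩
    · exact Or.inr ⟨by simpa using h, by simpa using hN⟩
  have h₂ : (Set.Ioc N (N + k)).ncard = k := by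
    rw [← Finset.coe_Ioc, Set.ncard_coe_finset, Nat.card_Ioc]; omega
  have h₃ := h₁.trans (Set.ncard_union_le _ _)
  rw [h₂] at h₃
  exact_mod_cast h₃

lemma proportion_union_le (A B : Set ℕ) (N : ℕ) :
    proportion (A ∪ B) N ≤ proportion A N + proportion B N := by
  unfold proportion
  rw [← add_div]
  gcongr
  have : {n : ℕ | n ∈ A ∪ B ∧ n ≤ N} = {n | n ∈ A ∧ n ≤ N} ∪ {n | n ∈ B ∧ n ≤ N} := by
    ext n; simp [or_and_right]
  rw [this]
  exact_mod_cast Set.ncard_union_le _ _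

lemma proportion_union_of_disjoint {A B : Set ℕ} (h : Disjoint A B) (N : ℕ) :
    proportion (A ∪ B) N = proportion A N + proportion B N := by
  unfold proportion
  rw [← add_div]
  have : {n : ℕ | n ∈ A ∪ B ∧ n ≤ N} = {n | n ∈ A ∧ n ≤ N} ∪ {n | n ∈ B ∧ n ≤ N} := by
    ext n; simp [or_and_right]
  rw [this, Set.ncard_union_eq (h.mono (fun _ hn => hn.1) (fun _ hn => hn.1))
    (finite_setOf_mem_and_le A N) (finite_setOf_mem_and_le B N)]
  push_cast
  rfl

lemma sum_proportion_le_one {m : ℕ} {A : Fin m → Set ℕ}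
    (h : Pairwise (Function.onFun Disjoint A)) (N : ℕ) : ∑ i, proportion (A i) N ≤ 1 := by
  have key : ∀ s : Finset (Fin m), ∑ i ∈ s, proportion (A i) N = proportion (⋃ i ∈ s, A i) N := by
    intro s
    induction s using Finset.induction_on with
    | empty => simp [proportion]
    | insert a s ha ih =>
      rw [Finset.sum_insert ha, ih, Finset.set_biUnion_insert, proportion_union_of_disjoint]
      rw [Set.disjoint_iUnion₂_right]
      intro i hi
      exact h fun hai => ha (hai ▸ hi)
  rw [key]
  exact proportion_le_one _ _

/-- Among `m` sets which are pairwise disjoint off `B`, one has proportion at most `1 / m` up to the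
proportion of `B`. -/
lemma exists_proportion_le {m : ℕ} (hm : 0 < m) {A : Fin m → Set ℕ} {B : Set ℕ}
    (h : ∀ i j, i ≠ j → A i ∩ A j ⊆ B) (N : ℕ) :
    ∃ i, proportion (A i) N ≤ 1 / m + proportion B N := by
  have : Nonempty (Fin m) := ⟨⟨0, hm⟩⟩
  have hdisj : Pairwise (Function.onFun Disjoint fun i => A i \ B) := by
    intro i j hij
    rw [Function.onFun, Set.disjoint_left]
    exact fun n hi hj => hi.2 (h i j hij ⟨hi.1, hj.1⟩)
  have hsum := sum_proportion_le_one hdisj N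
  obtain ⟨i, -, hi⟩ : ∃ i ∈ Finset.univ, proportion (A i \ B) N ≤ 1 / m := by
    refine Finset.exists_le_of_sum_le Finset.univ_nonempty (hsum.trans ?_)
    have : (m : ℝ) ≠ 0 := by positivity
    simp [this]
  refine ⟨i, ?_⟩
  calc proportion (A i) N ≤ proportion (A i \ B ∪ B) N :=
        proportion_mono (by simp) N
    _ ≤ _ := proportion_union_le _ _ _
    _ ≤ _ := by gcongr

lemma lowerDensity_le_of_frequently {A : Set ℕ} {ε : ℝ}
    (h : ∀ M, ∃ N ≥ M, proportion A N < ε) : lowerDensity A ≤ ε := by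
  refine liminf_le_of_frequently_le (frequently_atTop.2 fun M => ?_)
    (isBoundedUnder_of ⟨0, fun N => proportion_nonneg A N⟩)
  obtain ⟨N, hN, h⟩ := h M
  exact ⟨N, hN, h.le⟩

lemma lowerDensity_nonpos {A : Set ℕ}
    (h : ∀ ε > 0, ∀ M, ∃ N ≥ M, proportion A N < ε) : lowerDensity A ≤ 0 :=
  le_of_forall_pos_le_add fun ε hε => by
    simpa using lowerDensity_le_of_frequently (h ε hε)

/-- A set which meets a set of upper density one in a finite set has arbitrarily small proportions
along a sequence. -/
lemma exists_proportion_lt_of_upperDensity_eq_one {A B : Set ℕ} (hA : upperDensity A = 1)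
    (hB : ∀ᶠ n in atTop ⊓ 𝓟 A, n ∉ B) {ε : ℝ} (hε : 0 < ε) (M : ℕ) :
    ∃ N ≥ M, proportion B N < ε := by
  rw [eventually_inf_principal, eventually_atTop] at hB
  obtain ⟨F, hF⟩ := hB
  have hfreq : ∃ᶠ N in atTop, 1 - ε / 2 < proportion A N :=
    frequently_lt_of_lt_limsup
      (isCoboundedUnder_le_of_le atTop (x := 0) fun N => proportion_nonneg A N)
      (by change _ < upperDensity A; rw [hA]; linarith)
  have hlim : ∀ᶠ N : ℕ in atTop, (F : ℝ) / ((N : ℝ) + 1) < ε / 2 :=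
    ((tendsto_const_nhds.div_atTop
      (tendsto_natCast_atTop_atTop.atTop_add tendsto_const_nhds)).eventually
        (gt_mem_nhds (half_pos hε)))
  obtain ⟨N, h₁, h₂, h₃⟩ := (hfreq.and_eventually (hlim.and (eventually_ge_atTop M))).exists
  refine ⟨N, h₃, ?_⟩
  have hI : proportion (Set.Iio F) N ≤ F / ((N : ℝ) + 1) := by
    unfold proportion
    gcongr
    have : {n : ℕ | n ∈ Set.Iio F ∧ n ≤ N}.ncard ≤ (Set.Iio F).ncard :=
      Set.ncard_le_ncard (fun _ hn => hn.1) (Set.finite_Iio F)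
    have hF : (Set.Iio F).ncard = F := by
      rw [← Finset.coe_Iio, Set.ncard_coe_finset, Nat.card_Iio]
    exact this.trans hF.le
  -- From `F` on, `B` avoids `A`, so `B` has at most the room left by `A`.
  have hsub : B ⊆ B \ A ∪ Set.Iio F := by
    intro n hn
    by_cases hnA : n ∈ A
    · exact Or.inr (not_le.1 fun hle => hF n hle hnA hn)
    · exact Or.inl ⟨hn, hnA⟩
  have hd := proportion_union_of_disjoint (A := A) (B := B \ A) Set.disjoint_sdiff_right N
  have h1 := proportion_le_one (A ∪ B \ A) N
  have h2 := (proportion_mono hsub N).trans (proportion_union_le _ _ N)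
  linarith

end Density

section Operators

variable {𝕜 X : Type*} [RCLike 𝕜] [AddCommGroup X] [Module 𝕜 X] [TopologicalSpace X]

/-! ### Generic vectors and rare visits. -/

/-- The vectors whose orbits visit `C` up to some time `N ≥ M` with proportion less than `ε`. -/
def rarelyVisiting (T : X →L[𝕜] X) (C : Set X) (ε : ℝ) (M : ℕ) : Set X :=
  {x | ∃ N ≥ M, proportion (returnSet T x C) N < ε}

lemma isOpen_rarelyVisiting (T : X →L[𝕜] X) {C : Set X} (hC : IsClosed C) (ε : ℝ) (M : ℕ) :
    IsOpen (rarelyVisiting T C ε M) := by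
  rw [isOpen_iff_mem_nhds]
  rintro x ⟨N, hM, hN⟩
  have : ∀ᶠ y in 𝓝 x, ∀ n ∈ Set.Iic N, (T ^ n) x ∉ C → (T ^ n) y ∉ C := by
    rw [eventually_all_finite (Set.finite_Iic N)]
    intro n _
    by_cases h : (T ^ n) x ∈ C
    · exact Eventually.of_forall fun y hx => (hx h).elim
    · filter_upwards [(T ^ n).continuous.continuousAt.preimage_mem_nhds
        (hC.isOpen_compl.mem_nhds h)] with y hy _ using hy
  filter_upwards [this] with y hy
  exact ⟨N, hM, (proportion_le_of_forall_le fun n hn hyn =>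
    by_contra fun hx => hy n hn hx hyn).trans_lt hN⟩

lemma forall_rarelyVisiting_mem_residual (T : X →L[𝕜] X) {C : ℕ → Set X}
    (hC : ∀ k, IsClosed (C k)) (hd : ∀ k, ∀ ε > 0, ∀ M, Dense (rarelyVisiting T (C k) ε M)) :
    {x | ∀ k, ∀ ε > 0, ∀ M, x ∈ rarelyVisiting T (C k) ε M} ∈ residual X := by
  have h : ∀ k l M : ℕ, ∀ᶠ x in residual X, x ∈ rarelyVisiting T (C k) (1 / ((l : ℝ) + 1)) M :=
    fun k l M => residual_of_dense_open (isOpen_rarelyVisiting T (hC k) _ M)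
      (hd k _ (by positivity) M)
  have h' := eventually_countable_forall.2 fun k =>
    eventually_countable_forall.2 fun l => eventually_countable_forall.2 fun M => h k l M
  filter_upwards [h'] with x hx k ε hε M
  obtain ⟨l, hl⟩ := exists_nat_one_div_lt hε
  obtain ⟨N, hN, hlt⟩ := hx k l M
  exact ⟨N, hN, hlt.trans hl⟩

/-- If the orbit of `x` visits a set `C` around one of its points with zero lower density, then `x`
is not frequently recurrent. -/
lemma notMem_FRec (T : X →L[𝕜] X) {x : X} {C : Set X} {k : ℕ} (hC : C ∈ 𝓝 ((T ^ k) x))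
    (h : ∀ ε > 0, ∀ M, x ∈ rarelyVisiting T C ε M) : x ∉ FRec T := by
  intro hx
  refine (hx _ ((T ^ k).continuous.continuousAt.preimage_mem_nhds hC)).not_ge
    (lowerDensity_nonpos fun ε hε M => ?_)
  have hlim : ∀ᶠ N : ℕ in atTop, (k : ℝ) / ((N : ℝ) + 1) < ε / 2 :=
    ((tendsto_const_nhds.div_atTop
      (tendsto_natCast_atTop_atTop.atTop_add tendsto_const_nhds)).eventually
        (gt_mem_nhds (half_pos hε)))
  obtain ⟨M', hM'⟩ := eventually_atTop.1 hlim
  obtain ⟨N, hN, hlt⟩ := h (ε / 2) (half_pos hε) (max M M')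
  refine ⟨N, (le_max_left _ _).trans hN, ?_⟩
  -- Pulling `C` back to a neighbourhood of `x` shifts the return set by `k`, which costs at most `k
  -- / (N + 1)`.
  have hs : returnSet T x ((T ^ k) ⁻¹' C) = {n | n + k ∈ returnSet T x C} := by
    ext n
    simp only [returnSet, Set.mem_preimage, Set.mem_ofPred_eq]
    rw [add_comm n k, pow_add, mul_apply_eq_comp]
  have h₁ := proportion_preimage_add_le (returnSet T x C) k N
  have h₂ := hM' N ((le_max_right _ _).trans hN)
  rw [hs]
  linarith

/-! ### The three sources of meagreness. -/

lemma isMeagre_FRec_of_dense_distributionallyNearZero [T2Space X] [FirstCountableTopology X]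
    (hiso : ∀ x : X, (𝓝[≠] x).NeBot) (T : X →L[𝕜] X)
    (h : Dense {x : X | DistributionallyNearZero T x}) : IsMeagre (FRec T) := by
  obtain ⟨V, hV⟩ := (𝓝 (0 : X)).exists_antitone_basis
  have hne : ∀ᶠ x in residual X, x ≠ 0 :=
    residual_of_dense_open isOpen_compl_singleton (dense_compl_singleton 0)
  have hres := forall_rarelyVisiting_mem_residual T (C := fun k => (interior (V k))ᶜ)
    (fun k => isOpen_interior.isClosed_compl) fun k ε hε M => h.mono ?_
  · refine mem_of_superset (inter_mem hres hne) ?_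
    rintro x ⟨hx, hx0⟩
    obtain ⟨U, W, hU, hW, hUW⟩ := t2_separation_nhds hx0
    obtain ⟨k, hk⟩ := hV.mem_iff.1 hW
    refine notMem_FRec T (k := 0) (C := (interior (V k))ᶜ) ?_ (hx k)
    refine mem_of_superset hU fun y hy hyV => ?_
    exact Set.disjoint_left.1 hUW hy (hk (interior_subset hyV))
  · rintro x ⟨A, hA, hlim⟩
    refine exists_proportion_lt_of_upperDensity_eq_one hA ?_ hε M
    filter_upwards [hlim (interior_mem_nhds.2 (hV.mem k))] with n hn hn'
    exact hn' hn

/-- Perturb `y` by well-separated small multiples of `x₀`: two perturbed orbits can lie in `{p ≤ K}`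
at the same time `n` only if `p (Tⁿ x₀)` is bounded, which is rare. -/
lemma isMeagre_FRec_of_distributionallyUnbounded [IsTopologicalAddGroup X] [ContinuousSMul 𝕜 X]
    (T : X →L[𝕜] X) {x₀ : X} (h : DistributionallyUnbounded T x₀) : IsMeagre (FRec T) := by
  obtain ⟨A, hA, p, hp, hlim⟩ := h
  have hres := forall_rarelyVisiting_mem_residual T (C := fun K : ℕ => {x | p x ≤ K})
    (fun K => isClosed_le hp (continuous_const (y := (K : ℝ)))) fun K ε hε M => ?_
  · refine mem_of_superset hres fun x hx => ?_
    obtain ⟨K, hK⟩ := exists_nat_gt (p x)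
    have hnhds : {y | p y ≤ K} ∈ 𝓝 x := by
      filter_upwards [hp.continuousAt.eventually_lt_const hK] with y hy using hy.le
    exact notMem_FRec T (k := 0) hnhds (hx K)
  · rw [dense_iff_inter_open]
    rintro O hO ⟨y, hy⟩
    obtain ⟨m, hm⟩ := exists_nat_one_div_lt (half_pos hε)
    have hcont : ContinuousAt (fun c : 𝕜 => y + c • x₀) 0 := by fun_prop
    obtain ⟨r, hr, hball⟩ := Metric.mem_nhds_iff.1
      (hcont.preimage_mem_nhds (hO.mem_nhds (by simpa using hy)))
    -- Since `i ≤ m`, all multiples `t * i` stay below `r` while being `t`-separated.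
    set t : ℝ := r / ((m : ℝ) + 1) with ht
    have ht0 : 0 < t := by positivity
    let c : Fin (m + 1) → 𝕜 := fun i => ((t * (i : ℕ) : ℝ) : 𝕜)
    have hc : ∀ i, y + c i • x₀ ∈ O := by
      intro i
      refine hball ?_
      rw [mem_ball_zero_iff, RCLike.norm_ofReal, abs_of_nonneg (by positivity)]
      have : ((i : ℕ) : ℝ) < m + 1 := by exact_mod_cast i.2
      calc t * (i : ℕ) < t * (m + 1) := by gcongr
        _ = r := by rw [ht]; field_simp
    have hsep : ∀ i j, i ≠ j → t ≤ ‖c i - c j‖ := by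
      intro i j hij
      have h1 : c i - c j = ((t * ((i : ℕ) - (j : ℕ) : ℤ) : ℝ) : 𝕜) := by
        simp only [c]; push_cast; ring
      rw [h1, RCLike.norm_ofReal, abs_mul, abs_of_pos ht0]
      refine le_mul_of_one_le_right ht0.le ?_
      have : (1 : ℤ) ≤ |((i : ℕ) : ℤ) - (j : ℕ)| :=
        Int.one_le_abs (sub_ne_zero.2 fun h => hij (Fin.ext (by exact_mod_cast h)))
      exact_mod_cast this
    obtain ⟨N, hN, hlt⟩ := exists_proportion_lt_of_upperDensity_eq_one
      (B := {n | p ((T ^ n) x₀) ≤ 2 * K / t}) hA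
      (by filter_upwards [hlim.eventually_gt_atTop (2 * K / t)] with n hn using not_le.2 hn)
      (half_pos hε) M
    obtain ⟨i, hi⟩ := exists_proportion_le m.succ_pos
      (A := fun i => returnSet T (y + c i • x₀) {x | p x ≤ K})
      (B := {n | p ((T ^ n) x₀) ≤ 2 * K / t}) (fun i j hij n hn => by
        obtain ⟨hni, hnj⟩ := hn
        simp only [returnSet, Set.mem_ofPred_eq] at hni hnj ⊢
        rw [le_div_iff₀ ht0]
        have hsub : (c i - c j) • (T ^ n) x₀
            = (T ^ n) (y + c i • x₀) - (T ^ n) (y + c j • x₀) := by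
          simp only [map_add, map_smul, sub_smul]; abel
        calc p ((T ^ n) x₀) * t ≤ p ((T ^ n) x₀) * ‖c i - c j‖ := by
              gcongr
              exact hsep i j hij
          _ = p ((c i - c j) • (T ^ n) x₀) := by rw [map_smul_eq_mul, mul_comm]
          _ ≤ p ((T ^ n) (y + c i • x₀)) + p ((T ^ n) (y + c j • x₀)) := by
              rw [hsub]; exact map_sub_le_add p _ _
          _ ≤ 2 * K := by linarith) N
    refine ⟨y + c i • x₀, hc i, N, hN, ?_⟩
    rw [Nat.cast_succ] at hi
    linarith

/-- The shell `C` has ratio `3 / 2 < 2`, so at most one of the vectors `2 ^ i • Tⁿ z` lies in it.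
Each open set contains points `2 ^ i • T ^ k z` for every `i`, whose orbits are shifts of these. -/
lemma isMeagre_FRec_of_hypercyclic [T1Space X] [ContinuousSMul 𝕜 X]
    (hiso : ∀ x : X, (𝓝[≠] x).NeBot) (T : X →L[𝕜] X) (f : X →L[𝕜] 𝕜) (hf : f ≠ 0)
    (h : Hypercyclic T) : IsMeagre (FRec T) := by
  obtain ⟨z, hz⟩ := h
  let C : Set X := {x | 1 ≤ ‖f x‖ ∧ ‖f x‖ ≤ 3 / 2}
  let W : Set X := {x | 1 < ‖f x‖ ∧ ‖f x‖ < 3 / 2}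
  have hCc : IsClosed C :=
    (isClosed_le continuous_const f.continuous.norm).inter
      (isClosed_le f.continuous.norm continuous_const)
  have hWo : IsOpen W :=
    (isOpen_lt continuous_const f.continuous.norm).inter
      (isOpen_lt f.continuous.norm continuous_const)
  have hWn : W.Nonempty := by
    obtain ⟨v, hv⟩ : ∃ v, f v ≠ 0 := by
      by_contra! hcon
      exact hf (ContinuousLinearMap.ext hcon)
    refine ⟨(((5 / 4 : ℝ) : 𝕜) * (f v)⁻¹) • v, ?_⟩
    have : f ((((5 / 4 : ℝ) : 𝕜) * (f v)⁻¹) • v) = ((5 / 4 : ℝ) : 𝕜) := by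
      rw [map_smul, smul_eq_mul, inv_mul_cancel_right₀ hv]
    change 1 < ‖f _‖ ∧ ‖f _‖ < 3 / 2
    rw [this, RCLike.norm_ofReal]
    norm_num [abs_of_pos]
  have hvisit : ∀ᶠ x in residual X, ∃ n, (T ^ n) x ∈ W := by
    refine residual_of_dense_open (s := {x | ∃ n, (T ^ n) x ∈ W}) ?_ ?_
    · simp only [Set.ofPred_exists]
      exact isOpen_iUnion fun n => hWo.preimage (T ^ n).continuous
    · rw [dense_iff_inter_open]
      intro O hO hOn
      obtain ⟨_, hkO, k, rfl⟩ := hz.inter_open_nonempty O hO hOn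
      -- Without isolated points the orbit stays dense after dropping its first `k` terms, so `W` is
      -- reached at a time `n ≥ k`.
      have hz' := hz.sdiff_finite ((Set.finite_Iio k).image fun n => (T ^ n) z)
      obtain ⟨_, hW, ⟨n, rfl⟩, hn⟩ := hz'.inter_open_nonempty W hWo hWn
      have hkn : k ≤ n := not_lt.1 fun hlt => hn ⟨n, hlt, rfl⟩
      refine ⟨_, hkO, n - k, ?_⟩
      dsimp only at hW ⊢
      rwa [← mul_apply_eq_comp, ← pow_add, Nat.sub_add_cancel hkn]
  have hres := forall_rarelyVisiting_mem_residual T (C := fun _ => C) (fun _ => hCc)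
    fun _ ε hε M => ?_
  · refine mem_of_superset (inter_mem hres hvisit) ?_
    rintro x ⟨hx, n, hn⟩
    have hWC : W ⊆ C := fun y hy => ⟨hy.1.le, hy.2.le⟩
    exact notMem_FRec T (mem_of_superset (hWo.mem_nhds hn) hWC) (hx 0)
  · rw [dense_iff_inter_open]
    intro O hO hOn
    obtain ⟨m, hm⟩ := exists_nat_one_div_lt (half_pos hε)
    have horb : ∀ i : ℕ, ∃ k, (2 : 𝕜) ^ i • (T ^ k) z ∈ O := by
      intro i
      obtain ⟨o, ho⟩ := hOn
      obtain ⟨_, hk, k, rfl⟩ := hz.inter_open_nonempty ((fun x => (2 : 𝕜) ^ i • x) ⁻¹' O)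
        (hO.preimage (continuous_const_smul _)) ⟨((2 : 𝕜) ^ i)⁻¹ • o, by
          rwa [Set.mem_preimage, smul_inv_smul₀ (pow_ne_zero i two_ne_zero)]⟩
      exact ⟨k, hk⟩
    choose k hk using horb
    have hlim : ∀ᶠ N : ℕ in atTop, ∀ i : Fin (m + 1), (k i : ℝ) / ((N : ℝ) + 1) < ε / 2 :=
      eventually_all.2 fun i => ((tendsto_const_nhds.div_atTop
        (tendsto_natCast_atTop_atTop.atTop_add tendsto_const_nhds)).eventually
          (gt_mem_nhds (half_pos hε)))
    obtain ⟨N, hN, hMN⟩ := (hlim.and (eventually_ge_atTop M)).exists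
    have hlt : ∀ i j : ℕ, i < j → ∀ x : X, (2 : 𝕜) ^ i • x ∈ C → (2 : 𝕜) ^ j • x ∉ C := by
      rintro i j hij x ⟨hi, -⟩ ⟨-, hj⟩
      rw [map_smul, norm_smul, norm_pow, RCLike.norm_two] at hi hj
      have h2 : (2 : ℝ) ^ (i + 1) ≤ 2 ^ j := pow_le_pow_right₀ one_le_two hij
      have h3 := mul_le_mul_of_nonneg_right h2 (norm_nonneg (f x))
      rw [pow_succ] at h3
      linarith
    obtain ⟨i, hi⟩ := exists_proportion_le m.succ_pos
      (A := fun i : Fin (m + 1) => {n | (2 : 𝕜) ^ (i : ℕ) • (T ^ n) z ∈ C}) (B := ∅)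
      (fun i j hij n hn => by
        rcases lt_or_gt_of_ne (Fin.val_ne_of_ne hij) with hlt' | hlt'
        · exact hlt _ _ hlt' _ hn.1 hn.2
        · exact hlt _ _ hlt' _ hn.2 hn.1) N
    refine ⟨_, hk i, N, hMN, ?_⟩
    have hs : returnSet T ((2 : 𝕜) ^ (i : ℕ) • (T ^ k i) z) C
        = {n | n + k i ∈ {n | (2 : 𝕜) ^ (i : ℕ) • (T ^ n) z ∈ C}} := by
      ext n
      simp only [returnSet, Set.mem_ofPred_eq, map_smul, pow_add, mul_apply_eq_comp]
    have h₁ := proportion_preimage_add_le {n | (2 : 𝕜) ^ (i : ℕ) • (T ^ n) z ∈ C} (k i) N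
    have h₂ := hN i
    have h₃ : proportion ∅ N = 0 := by simp [proportion]
    rw [hs]
    rw [Nat.cast_succ] at hi
    linarith

lemma DistributionallyNearZero.of_tendsto {T : X →L[𝕜] X} {x : X}
    (h : Tendsto (fun n : ℕ => (T ^ n) x) atTop (𝓝 0)) : DistributionallyNearZero T x := by
  refine ⟨Set.univ, ?_, h.mono_left inf_le_left⟩
  have : proportion Set.univ = fun _ => 1 := by
    ext N
    have h' : {n : ℕ | n ∈ Set.univ ∧ n ≤ N} = (Finset.Iic N : Finset ℕ) := by ext; simp
    rw [proportion, h', Set.ncard_coe_finset, Nat.card_Iic]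
    push_cast
    exact div_self (by positivity)
  rw [upperDensity, this, limsup_const]

end Operators

end LinRec

/-- `X` is a nonzero real or complex Fréchet space (a complete metrizable locally convex
topological vector space) and `T` is a continuous linear operator on `X`. -/
theorem theorem2p8 {𝕜 X : Type*} [RCLike 𝕜] [AddCommGroup X] [Module 𝕜 X]
    [Module ℝ X] [IsScalarTower ℝ 𝕜 X]
    [UniformSpace X] [IsUniformAddGroup X] [ContinuousSMul 𝕜 X] [LocallyConvexSpace ℝ X]
    [TopologicalSpace.MetrizableSpace X] [CompleteSpace X] [Nontrivial X]
    (T : X →L[𝕜] X)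
    (h : LinRec.Hypercyclic T ∨
      (∃ x : X, LinRec.DistributionallyUnbounded T x) ∨
      Dense {x : X | LinRec.DistributionallyNearZero T x} ∨
      Dense {x : X | Tendsto (fun n : ℕ => (T ^ n) x) atTop (𝓝 0)}) :
    IsMeagre (LinRec.FRec T) := by
  have hiso : ∀ x : X, (𝓝[≠] x).NeBot := fun x => Module.punctured_nhds_neBot 𝕜 X x
  rcases h with h | ⟨x, h⟩ | h | h
  · obtain ⟨x, hx⟩ := exists_ne (0 : X)
    have : ContinuousSMul ℝ X := IsScalarTower.continuousSMul 𝕜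
    obtain ⟨f, hf⟩ := RCLike.geometric_hahn_banach_point_point (𝕜 := 𝕜) hx
    exact LinRec.isMeagre_FRec_of_hypercyclic hiso T f (fun h0 => by simp [h0] at hf) h
  · exact LinRec.isMeagre_FRec_of_distributionallyUnbounded T h
  · exact LinRec.isMeagre_FRec_of_dense_distributionallyNearZero hiso T h
  · exact LinRec.isMeagre_FRec_of_dense_distributionallyNearZero hiso T
      (h.mono fun _ hx => LinRec.DistributionallyNearZero.of_tendsto hx)
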